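/- Let $\mathbb F_q$ be a finite field and let $V=\mathbb F_q^{\oplus\omega}$ be the $\mathbb F_q$-vector space of countably infinite dimension. Let $G$ be one of the following groups: $\mathrm{GL}(V)$, the group of all linear automorphisms of $V$; $\mathrm O(V)$, the group of all linear automorphisms of $V$ preserving a given non-degenerate symmetric bilinear form $f$ on $V$; or $\mathrm{Sp}(V)$, the group of all linear automorphisms of $V$ preserving a given non-degenerate alternating bilinear form $f$ on $V$ (for every choice of $f$). For $r\ge 0$ let $\mathbf F_r$ be the free group on $x_1,\dots,x_r$. An element $w\in G*\mathbf F_r$ is a *mixed identity* for $G$ if $w\neq 1$ and $w(h_1,\dots,h_r)=1$ for all $h_1,\dots,h_r\in G$, where $w(h_1,\dots,h_r)$ is obtained by substituting $h_i$ for $x_i$. It is *non-singular* if its image under the homomorphism $G*\mathbf F_r\to\mathbf F_r$ that kills $G$ and fixes $\mathbf F_r$ is non-trivial. If $w=c_0x_{\iota(1)}^{\varepsilon(1)}c_1\cdots x_{\iota(l)}^{\varepsilon(l)}c_l$ with $c_j\in G$ and $\varepsilon(j)\in\{\pm1\}$, then $c_j$ ($1\le j\le l-1$) is called a *critical constant*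 of this expression if $\iota(j)=\iota(j+1)$ and $\varepsilon(j)=-\varepsilon(j+1)$. View $V$ as a relational structure with the relations $\{(v_1,\dots,v_n)\in V^n : \sum_i\lambda_iv_i=0\}$ for $n\in\mathbb N$ and $\lambda_1,\dots,\lambda_n\in\mathbb F_q$ and, when $G=\mathrm O(V)$ or $G=\mathrm{Sp}(V)$, also with the relations $\{(u,v)\in V^2 : f(u,v)=\mu\}$ for $\mu\in\mathbb F_q$; its automorphism group is $G$. For $Y\subseteq V$ let $\mathrm{acl}(Y)$ be the set of all $v\in V$ for which there is a finite $W\subseteq Y$ such that the orbit of $v$ under the pointwise stabilizer of $W$ in $G$ is finite. An element $c\in G$ is *slender* if there are a finite set $Y\subseteq V$ and an infinite set $Z\subseteq V$, first-order definable with parameters, such that $c(v)\in\mathrm{acl}(Y\cup\{v\})$ for all $v\in Z$. Then: 1. $G$ admits no non-singular mixed identity, in any number of variables. 2. For every mixed identity $w$ of $G$, every expression of $w$ as above has a critical constant $c$ such that $\mathrm{rk}(c-\lambda\,\mathrm{id})<\infty$ for some $\lambda\in\mathbb F_q$. 3. An element $c\in G$ is slender if and only if $\mathrm{rk}(c-\lambda\,\mathrm{id})<\infty$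 for some $\lambda\in\mathbb F_q$. -/

import Mathlib

namespace MixedIdentity

open scoped FirstOrder

universe u v w

/-! ### Words with constants and mixed identities -/

section Words

variable {G : Type u} [Group G] {r : ℕ}

/-- The unique homomorphism `G ∗ F_r → G` fixing `G` elementwise and sending `x_i` to `h i`;
`evalAt h w` is the value `w(h_1, …, h_r)` of the word map. -/
def evalAt (h : Fin r → G) : Monoid.Coprod G (FreeGroup (Fin r)) →* G :=
  Monoid.Coprod.lift (MonoidHom.id G) (FreeGroup.lift h)

/-- `w` is a mixed identity for `G`: it is a nontrivial element of `G ∗ F_r` whose word map is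
constantly `1`. -/
def IsMixedIdentity (w : Monoid.Coprod G (FreeGroup (Fin r))) : Prop :=
  w ≠ 1 ∧ ∀ h : Fin r → G, evalAt h w = 1

/-- `w` is non-singular: its content, i.e. its image under the natural augmentation
`G ∗ F_r → F_r`, is nontrivial. -/
def IsNonsingular (w : Monoid.Coprod G (FreeGroup (Fin r))) : Prop :=
  (Monoid.Coprod.snd : Monoid.Coprod G (FreeGroup (Fin r)) →* FreeGroup (Fin r)) w ≠ 1

variable (G r)

/-- One syllable `x_ι ^ ε · c` of a word with constants; the sign `ε` is `+1` for `true` and `-1`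
for `false`. -/
structure Syllable where
  /-- the index `ι` of the variable -/
  var : Fin r
  /-- the sign `ε` of the exponent -/
  sign : Bool
  /-- the constant `c` following the variable -/
  const : G

/-- A formal word `c_0 x_{ι(1)}^{ε(1)} c_1 ⋯ x_{ι(l)}^{ε(l)} c_l`, where `l` is the number of
syllables. -/
structure WordExpr where
  /-- the constant `c_0` -/
  head : G
  /-- the syllables `x_{ι(j)}^{ε(j)} c_j`, `j = 1, …, l` -/
  tail : List (Syllable G r)

variable {G r}

/-- The element `x_ι ^ ε · c` of the free product. -/
def Syllable.toCoprod (s : Syllable G r) : Monoid.Coprod G (FreeGroup (Fin r)) :=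
  Monoid.Coprod.inr (if s.sign then FreeGroup.of s.var else (FreeGroup.of s.var)⁻¹) *
    Monoid.Coprod.inl s.const

/-- The element of the free product written by a formal word. -/
def WordExpr.toCoprod (e : WordExpr G r) : Monoid.Coprod G (FreeGroup (Fin r)) :=
  Monoid.Coprod.inl e.head * (e.tail.map Syllable.toCoprod).prod

/-- `c` is a critical constant of the formal word `e`: it is `c_j` for some `1 ≤ j ≤ l - 1` with
`ι(j) = ι(j+1)` and `ε(j) = -ε(j+1)`. -/
def WordExpr.IsCriticalConstant (e : WordExpr G r) (c : G) : Prop :=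
  ∃ (s t : Syllable G r), [s, t] <:+: e.tail ∧ s.var = t.var ∧ s.sign = !t.sign ∧ s.const = c

end Words

/-! ### Algebraic closure and slender automorphisms -/

section Slender

variable (L : FirstOrder.Language.{u, v}) {X : Type w} [L.Structure X]

/-- `x` lies in the algebraic closure of `Y`: for some finite `W ⊆ Y`, the orbit of `x` under the
pointwise stabilizer of `W` in the automorphism group is finite. -/
def acl (Y : Set X) : Set X :=
  {x | ∃ W : Set X, W.Finite ∧ W ⊆ Y ∧
    {y | ∃ g : X ≃[L] X, (∀ a ∈ W, g a = a) ∧ g x = y}.Finite}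

/-- The automorphism `c` is slender: there are a finite set `Y` and an infinite set `Z`, definable
with parameters, such that `c x ∈ acl (Y ∪ {x})` for all `x ∈ Z`. -/
def IsSlender (c : X ≃[L] X) : Prop :=
  ∃ Y Z : Set X, Y.Finite ∧ Z.Infinite ∧ (Set.univ : Set X).Definable₁ L Z ∧
    Z ⊆ {x | c x ∈ acl L (Y ∪ {x})}

end Slender

/-! ### The vector space `F^{⊕ω}` and its groups -/

section VectorSpace

variable (F : Type u) [Field F]

/-- The vector space `F^{⊕ω}` of countably infinite dimension. -/
abbrev Space : Type u := ℕ →₀ F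

/-- The general linear group of `F^{⊕ω}`. -/
abbrev LinAut : Type u := Space F ≃ₗ[F] Space F

/-- The relational language with one `n`-ary relation symbol `R_λ` for each `λ ∈ F^n`. -/
def vecLang : FirstOrder.Language.{0, u} where
  Functions _ := Empty
  Relations n := Fin n → F

/-- `F^{⊕ω}` as a relational structure: `R_λ (x_1, …, x_n)` means `∑ λ_i x_i = 0`. -/
instance vecStructure : (vecLang F).Structure (Space F) where
  funMap f := f.elim
  RelMap {n} (a : Fin n → F) x := ∑ i, a i • x i = 0

/-- Symbols for the relations `R_λ` with `λ ∈ F^n`, and binary symbols `B_μ` with `μ ∈ F`. -/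
inductive FormRel (F : Type u) : ℕ → Type u
  | lin {n : ℕ} (a : Fin n → F) : FormRel F n
  | form (μ : F) : FormRel F 2

/-- The relational language of vector spaces over `F` with a bilinear form. -/
def formLang : FirstOrder.Language.{0, u} where
  Functions _ := Empty
  Relations n := FormRel F n

variable {F}

/-- The meaning of the relation symbols for a bilinear form `f`: `R_λ (x_1, …, x_n)` means
`∑ λ_i x_i = 0`, and `B_μ (x, y)` means `f x y = μ`. -/
def formRelMap (f : LinearMap.BilinForm F (Space F)) :
    {n : ℕ} → FormRel F n → (Fin n → Space F) → Prop
  | _, .lin a, x => ∑ i, a i • x i = 0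
  | _, .form μ, x => f (x 0) (x 1) = μ

/-- `F^{⊕ω}` with the bilinear form `f` as a relational structure. -/
@[reducible]
def formStructure (f : LinearMap.BilinForm F (Space F)) : (formLang F).Structure (Space F) where
  funMap φ := φ.elim
  RelMap R x := formRelMap f R x

/-- The group of all linear automorphisms of `F^{⊕ω}` preserving the bilinear form `f`. It is the
orthogonal group if `f` is symmetric and non-degenerate, and the symplectic group if `f` is
alternating and non-degenerate. -/
def isometryGroup (f : LinearMap.BilinForm F (Space F)) : Subgroup (LinAut F) where
  carrier := {g | ∀ x y, f (g x) (g y) = f x y}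
  mul_mem' {a b} ha hb x y := by
    change f (a (b x)) (a (b y)) = f x y
    rw [ha, hb]
  one_mem' _ _ := rfl
  inv_mem' {a} ha x y := by
    change f (a.symm x) (a.symm y) = f x y
    rw [← ha, a.apply_symm_apply, a.apply_symm_apply]

lemma lin_map_iff (c : LinAut F) {n : ℕ} (a : Fin n → F) (x : Fin n → Space F) :
    ∑ i, a i • c (x i) = 0 ↔ ∑ i, a i • x i = 0 := by
  have h : ∑ i, a i • c (x i) = c (∑ i, a i • x i) := by simp
  rw [h, c.map_eq_zero_iff]

/-- A linear automorphism as an automorphism of the relational structure `F^{⊕ω}`. -/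
noncomputable def toVecAut (c : LinAut F) : Space F ≃[vecLang F] Space F where
  toEquiv := c.toEquiv
  map_fun' φ := φ.elim
  map_rel' a x := lin_map_iff c a x

lemma form_map_iff {f : LinearMap.BilinForm F (Space F)} (c : isometryGroup f) {n : ℕ}
    (R : FormRel F n) (x : Fin n → Space F) :
    formRelMap f R ((c : LinAut F) ∘ x) ↔ formRelMap f R x := by
  cases R with
  | lin a => exact lin_map_iff (c : LinAut F) a x
  | form μ =>
    change f ((c : LinAut F) (x 0)) ((c : LinAut F) (x 1)) = μ ↔ f (x 0) (x 1) = μ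
    rw [c.2 (x 0) (x 1)]

/-- `c ∈ GL(F^{⊕ω})` is slender as an automorphism of the relational structure `F^{⊕ω}`. -/
def IsSlenderLinear (c : LinAut F) : Prop := IsSlender (vecLang F) (toVecAut c)

/-- An isometry of `f` as an automorphism of the relational structure `(F^{⊕ω}, f)`. -/
noncomputable def toFormAut (f : LinearMap.BilinForm F (Space F)) (c : isometryGroup f) :
    letI := formStructure f
    Space F ≃[formLang F] Space F :=
  letI := formStructure f
  { toEquiv := (c : LinAut F).toEquiv
    map_fun' := fun φ => φ.elim
    map_rel' := fun R x => form_map_iff c R x }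

/-- The isometry `c` of `f` is slender as an automorphism of the relational structure
`(F^{⊕ω}, f)`. -/
def IsSlenderIsometry (f : LinearMap.BilinForm F (Space F)) (c : isometryGroup f) : Prop :=
  letI := formStructure f
  IsSlender (formLang F) (toFormAut f c)

/-- `rk (c - μ • id) < ∞` for some `μ ∈ F`. -/
def IsScalarModFiniteRank (c : LinAut F) : Prop :=
  ∃ μ : F, LinearMap.rank ((c : Space F →ₗ[F] Space F) - μ • LinearMap.id) < Cardinal.aleph0

end VectorSpace

end MixedIdentity

/-! Everything rests on one property of the groups, `IsRichOver`: the pointwise stabilizer of a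
finite-dimensional `W ⊇ E` moves any `z ∉ W` over a set that is, up to finite-dimensional error, a
translate of a finite-codimensional subspace. It comes from transvections for `GL`, for alternating
forms and in characteristic 2, and from Siegel transformations otherwise. If `d` maps each such
image `t z` into `U + ⟨t z⟩`, with `U` finite-dimensional, then, `F` being finite, finitely many
cosets of the subspaces `(d - μ)⁻¹(U')` cover a finite-codimensional subspace. By B. H. Neumann's
lemma one of them has finite index, so `d - μ` has finite rank
(`IsRichOver.exists_finiteDimensional_range`).

Slenderness follows because `acl` is the span up to `E`. For words, group elements are prescribed
one value at a time along the trajectory of a vector, each new value being generic. If no critical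
constant is scalar modulo finite rank, this never gets stuck, and `1 - w(h)` attains arbitrarily
large rank (`IsGood.exists_le_finrank`), which gives the claim on critical constants. An arbitrary
word becomes such a word by cancelling around the bad constants; this keeps the content and changes
values by bounded rank (`exists_isGood`), so non-singular identities are impossible. -/

namespace MixedIdentity

open Cardinal
open scoped Pointwise FirstOrder

universe u v w

/-! ### Rich groups and generic points of orbits -/

section Rich

variable {F : Type u} [Field F] {V : Type v} [AddCommGroup V] [Module F V]

/-- `c` differs from a scalar by an endomorphism of finite rank. -/
def IsScalarModFiniteRange (c : V ≃ₗ[F] V) : Prop :=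
  ∃ μ : F, FiniteDimensional F (LinearMap.range ((c : V →ₗ[F] V) - μ • LinearMap.id))

/-- For every finite-dimensional `W ⊇ E` and every `z ∉ W`, the orbit of `z` under the pointwise
stabilizer of `W` in `G` contains, up to a finite-dimensional error, a translate of a subspace of
finite codimension. -/
def IsRichOver (G : Subgroup (V ≃ₗ[F] V)) (E : Submodule F V) : Prop :=
  ∀ W : Submodule F V, FiniteDimensional F W → E ≤ W → ∀ z ∉ W,
    ∃ A P : Submodule F V, A.CoFG ∧ FiniteDimensional F P ∧
      ∀ v ∈ A, ∃ t ∈ G, (∀ w ∈ W, t w = w) ∧ t z - z - v ∈ P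

theorem exists_notMem_of_not_finiteDimensional (hV : ¬ FiniteDimensional F V)
    (U : Submodule F V) [FiniteDimensional F U] :
    ∃ v, v ∉ U := by
  by_contra! h
  have hU : U = ⊤ := Submodule.eq_top_iff'.2 h
  subst hU
  exact hV (Module.Finite.equiv (Submodule.topEquiv (R := F)))

/-- `A` has finite index because `F` is finite, so translating the given cosets by representatives
of `M ⧸ A` covers `M`, and Neumann's lemma on coset covers applies. -/
theorem cofg_of_subset_iUnion_translate [Finite F] {M : Type*} [AddCommGroup M] [Module F M]
    {ι : Type*} [Finite ι] {A : Submodule F M} (hA : A.CoFG) (g : ι → M) (B : ι → Submodule F M)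
    (h : ∀ v ∈ A, ∃ i, v - g i ∈ B i) : ∃ i, (B i).CoFG := by
  classical
  have : Module.Finite F (M ⧸ A) := hA
  have : Finite (M ⧸ A) := Module.finite_of_finite F
  have := Fintype.ofFinite ((M ⧸ A) × ι)
  have key : ⋃ i ∈ (Finset.univ : Finset ((M ⧸ A) × ι)),
      (i.1.out + g i.2) +ᵥ ((B i.2).toAddSubgroup : Set M) = Set.univ := by
    refine Set.eq_univ_of_forall fun x => ?_
    have hx : x - (Submodule.Quotient.mk (p := A) x).out ∈ A := by
      rw [← Submodule.Quotient.eq]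
      exact (Quotient.out_eq _).symm
    obtain ⟨i, hi⟩ := h _ hx
    simp only [Finset.mem_univ, Set.iUnion_true, Set.mem_iUnion]
    refine ⟨(Submodule.Quotient.mk x, i), ?_⟩
    rw [Set.mem_vadd_set_iff_neg_vadd_mem]
    simp only [vadd_eq_add, SetLike.mem_coe, Submodule.mem_toAddSubgroup]
    convert hi using 1
    abel
  obtain ⟨k, -, hk⟩ := AddSubgroup.exists_finiteIndex_of_leftCoset_cover key
  refine ⟨k.2, ?_⟩
  have : Finite (M ⧸ (B k.2).toAddSubgroup) := inferInstance
  have : Finite (M ⧸ B k.2) := this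
  exact Module.Finite.of_finite

theorem finiteDimensional_range_of_comap_cofg {f : V →ₗ[F] V} {U : Submodule F V}
    [FiniteDimensional F U] (h : (U.comap f).CoFG) : FiniteDimensional F (LinearMap.range f) := by
  rw [← Submodule.fg_iff_finiteDimensional]
  refine Submodule.fg_of_fg_map_of_fg_inf_ker U.mkQ ?_ ?_
  · rw [← LinearMap.range_comp, Submodule.range_fg_iff_ker_cofg, LinearMap.ker_comp,
      Submodule.ker_mkQ]
    exact h
  · rw [Submodule.ker_mkQ, Submodule.fg_iff_finiteDimensional]
    exact Submodule.finiteDimensional_inf_right _ _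

theorem not_finiteDimensional_range (hV : ¬ FiniteDimensional F V) (d : V ≃ₗ[F] V) :
    ¬ FiniteDimensional F (LinearMap.range (d : V →ₗ[F] V)) := by
  rw [LinearEquiv.range]
  intro h
  exact hV (Module.Finite.equiv (Submodule.topEquiv (R := F)))

variable [Finite F] {G : Subgroup (V ≃ₗ[F] V)} {E : Submodule F V}

theorem IsRichOver.exists_finiteDimensional_range (hG : IsRichOver G E) {W U : Submodule F V}
    [hW : FiniteDimensional F W] [FiniteDimensional F U] (hE : E ≤ W) {z : V} (hz : z ∉ W)
    (d : V →ₗ[F] V) (Λ : Set F)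
    (h : ∀ t ∈ G, (∀ w ∈ W, t w = w) → ∃ μ ∈ Λ, d (t z) - μ • t z ∈ U) :
    ∃ μ ∈ Λ, FiniteDimensional F (LinearMap.range (d - μ • LinearMap.id)) := by
  obtain ⟨A, P, hA, hP, hAP⟩ := hG W hW hE z hz
  -- Large enough to absorb replacing `t z` by `z + v` in `d (t z) - μ • t z`, the difference `t z -
  -- z - v` lying in `P`.
  set U' := U ⊔ P ⊔ P.map d with hU'
  let S : Set F := {μ ∈ Λ | ∃ v, (d - μ • LinearMap.id : V →ₗ[F] V) (z + v) ∈ U'}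
  choose g hg using fun μ : S => μ.2.2
  have hcov : ∀ v ∈ A, ∃ μ : S, v - g μ ∈ U'.comap (d - (μ : F) • LinearMap.id) := by
    intro v hv
    obtain ⟨t, htG, htW, htP⟩ := hAP v hv
    obtain ⟨μ, hμ, hμU⟩ := h t htG htW
    have hmem : (d - μ • LinearMap.id : V →ₗ[F] V) (z + v) ∈ U' := by
      have e : (d - μ • LinearMap.id : V →ₗ[F] V) (z + v) =
          (d (t z) - μ • t z) + μ • (t z - z - v) - d (t z - z - v) := by
        simp only [LinearMap.sub_apply, LinearMap.smul_apply, LinearMap.id_apply, map_add,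
          map_sub, smul_sub]
        abel
      rw [e]
      refine sub_mem (add_mem ?_ (Submodule.smul_mem _ _ ?_)) ?_
      · exact Submodule.mem_sup_left (Submodule.mem_sup_left hμU)
      · exact Submodule.mem_sup_left (Submodule.mem_sup_right htP)
      · exact Submodule.mem_sup_right (Submodule.mem_map_of_mem htP)
    refine ⟨⟨μ, hμ, v, hmem⟩, ?_⟩
    have e : v - g ⟨μ, hμ, v, hmem⟩ = (z + v) - (z + g ⟨μ, hμ, v, hmem⟩) := by abel
    rw [Submodule.mem_comap, e, map_sub]
    exact sub_mem hmem (hg ⟨μ, hμ, v, hmem⟩)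
  obtain ⟨μ, hμ⟩ := cofg_of_subset_iUnion_translate hA g _ hcov
  exact ⟨μ, μ.2.1, finiteDimensional_range_of_comap_cofg hμ⟩

/-- A generic point of the orbit of `z` under the pointwise stabilizer of `W`. -/
theorem IsRichOver.exists_generic (hV : ¬ FiniteDimensional F V) (hG : IsRichOver G E)
    {W U : Submodule F V} [FiniteDimensional F W] [FiniteDimensional F U] (hE : E ≤ W) {z : V}
    (hz : z ∉ W) (d : V ≃ₗ[F] V) : ∃ t ∈ G, (∀ w ∈ W, t w = w) ∧ d (t z) ∉ U ∧
      (¬ IsScalarModFiniteRange d → d (t z) ∉ U ⊔ Submodule.span F {t z}) := by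
  -- In the scalar case only `d (t z) ∉ U` is at stake: if it failed throughout, the value `μ = 0`
  -- alone would do, and the automorphism `d` would have finite rank.
  by_cases hd : IsScalarModFiniteRange d
  · by_contra! h
    obtain ⟨μ, hμ, hr⟩ := hG.exists_finiteDimensional_range (U := U) hE hz d {0} fun t ht htW =>
      ⟨0, rfl, by
        by_contra h0
        simp only [zero_smul, sub_zero] at h0
        exact (h t ht htW h0).1 hd⟩
    rw [Set.mem_singleton_iff] at hμ
    subst hμ
    exact not_finiteDimensional_range hV d (by rwa [zero_smul, sub_zero] at hr)
  · by_contra! h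
    obtain ⟨μ, -, hr⟩ := hG.exists_finiteDimensional_range (U := U) hE hz d Set.univ
      fun t ht htW => by
      have hmem : d (t z) ∈ U ⊔ Submodule.span F {t z} := by
        by_contra h0
        exact h0 (h t ht htW fun h1 => h0 (Submodule.mem_sup_left h1)).2
      obtain ⟨x, hx, y, hy, hxy⟩ := Submodule.mem_sup.1 hmem
      obtain ⟨μ, rfl⟩ := Submodule.mem_span_singleton.1 hy
      refine ⟨μ, trivial, ?_⟩
      rw [LinearEquiv.coe_coe, ← hxy, add_sub_cancel_right]
      exact hx
    exact hd ⟨μ, hr⟩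

end Rich

/-! ### Richness of the linear, symplectic and orthogonal groups -/

section RichGroups

variable {F : Type u} [Field F] {V : Type v} [AddCommGroup V] [Module F V]

/-- A functional killing `W` but not `z` gives transvections that fix `W` and send `z` exactly to `z
+ v`, for all `v` in its kernel. -/
theorem isRichOver_top [Finite F] : IsRichOver (⊤ : Subgroup (V ≃ₗ[F] V)) ⊥ := by
  intro W _ _ z hz
  obtain ⟨θ, hθz, hθW⟩ := Submodule.exists_le_ker_of_notMem hz
  refine ⟨LinearMap.ker θ, ⊥, Submodule.CoFG.ker θ,
    inferInstance, fun v hv => ⟨LinearEquiv.transvection (f := (θ z)⁻¹ • θ) (v := v) ?_,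
      trivial, fun w hw => ?_, ?_⟩⟩
  · rw [LinearMap.smul_apply, LinearMap.mem_ker.1 hv, smul_zero]
  · have := LinearMap.mem_ker.1 (hθW hw)
    change w + ((θ z)⁻¹ * θ w) • v = w
    simp [this]
  · change z + ((θ z)⁻¹ * θ z) • v - z - v ∈ _
    simp [hθz]

variable {f : LinearMap.BilinForm F V}

/-- By non-degeneracy, a vector orthogonal to `H` is determined by its pairing with a
finite-dimensional complement of `H`. -/
theorem finiteDimensional_orthogonal (hf : ∀ x, (∀ y, f y x = 0) → x = 0) {H : Submodule F V}
    (hH : H.CoFG) : FiniteDimensional F (f.orthogonal H) := by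
  obtain ⟨C, hC⟩ := H.exists_isCompl
  have hfin : FiniteDimensional F C := Module.Finite.iff_fg.2 (hH.fg_of_isCompl hC)
  refine FiniteDimensional.of_injective
    ((f.flip.compl₂ C.subtype).domRestrict (f.orthogonal H)) ?_
  rw [← LinearMap.ker_eq_bot, LinearMap.ker_eq_bot']
  rintro ⟨x, hx⟩ h
  refine Subtype.ext (hf x fun y => ?_)
  obtain ⟨a, ha, b, hb, rfl⟩ := Submodule.mem_sup.1 (hC.sup_eq_top ▸ Submodule.mem_top : y ∈ H ⊔ C)
  have hb' : f b x = 0 := LinearMap.congr_fun h ⟨b, hb⟩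
  have ha' : f a x = 0 := hx a ha
  rw [map_add, LinearMap.add_apply, ha', hb', add_zero]

theorem cofg_orthogonal (W : Submodule F V) [FiniteDimensional F W] : (f.orthogonal W).CoFG := by
  have h : f.orthogonal W = LinearMap.ker (f.flip.compl₂ W.subtype) := by
    ext x
    rw [LinearMap.mem_ker]
    exact ⟨fun hx => LinearMap.ext fun w => hx w w.2, fun hx w hw => LinearMap.congr_fun hx ⟨w, hw⟩⟩
  rw [h]
  exact Submodule.CoFG.ker _

theorem exists_mem_orthogonal_apply_eq_one [Finite F] (hr : ∀ x y, f x y = 0 → f y x = 0)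
    {H W : Submodule F V} [FiniteDimensional F W] (hHW : f.orthogonal H ≤ W) {z : V}
    (hz : z ∉ W) : ∃ a ∈ H ⊓ f.orthogonal W, f z a = 1 := by
  suffices h : ∃ a ∈ H ⊓ f.orthogonal W, f z a ≠ 0 by
    obtain ⟨a, ha, hza⟩ := h
    exact ⟨(f z a)⁻¹ • a, Submodule.smul_mem _ _ ha, by simp [hza]⟩
  by_contra! h
  have : Finite W := Module.finite_of_finite F
  let L : W →ₗ[F] Module.Dual F H := (f.compl₂ H.subtype).domRestrict W
  -- On `H`, the functional `f z` vanishes on the common kernel of the `f w`, so it equals some `f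
  -- w`; then `z - w ∈ H^⊥ ≤ W`.
  have hK : (f.compl₂ H.subtype z : Module.Dual F H) ∈ Submodule.span F (Set.range L) := by
    refine mem_span_of_iInf_ker_le_ker fun a ha => ?_
    rw [Submodule.mem_iInf] at ha
    exact h a ⟨a.2, fun w hw => ha ⟨w, hw⟩⟩
  rw [← LinearMap.coe_range, Submodule.span_eq] at hK
  obtain ⟨w, hw⟩ := hK
  refine hz ?_
  have : z - w ∈ f.orthogonal H := fun a ha => hr _ _ <| by
    have h1 : f w a = f z a := LinearMap.congr_fun hw ⟨a, ha⟩
    rw [map_sub, LinearMap.sub_apply, h1, sub_self]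
  simpa using add_mem (hHW this) w.2

/-- Covers alternating forms and symmetric forms in characteristic 2. Skewness makes `x ↦ f x x`
additive, so its kernel `H` has finite index. The transvection along an isotropic `a + v` is an
isometry; with `f z a = 1` and `f z v = 0` it sends `z` to `z + a + v`. The choice `E = H^⊥` is what
guarantees a suitable `a` inside `H`. -/
theorem exists_isRichOver_of_skew [Finite F] {G : Subgroup (V ≃ₗ[F] V)}
    (hG : ∀ g : V ≃ₗ[F] V, (∀ x y, f (g x) (g y) = f x y) → g ∈ G)
    (hf : ∀ x, (∀ y, f y x = 0) → x = 0) (hs : ∀ x y, f x y = - f y x) :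
    ∃ E : Submodule F V, FiniteDimensional F E ∧ IsRichOver G E := by
  have hadd : ∀ a b, f (a + b) (a + b) = f a a + f b b := fun a b => by
    simp only [map_add, LinearMap.add_apply]
    rw [hs b a]
    ring
  let q : V →+ F := AddMonoidHom.mk' (fun a => f a a) hadd
  let H : Submodule F V :=
    { q.ker with
      smul_mem' := fun c x hx => by
        have hx' : f x x = 0 := hx
        change f (c • x) (c • x) = 0
        simp [hx'] }
  have hHq : ∀ {a}, a ∈ H → f a a = 0 := fun h => h
  have hH : H.CoFG := by
    have : q.ker.FiniteIndex := AddSubgroup.finiteIndex_ker q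
    have : Finite (V ⧸ q.ker) := inferInstance
    have : Finite (V ⧸ H) := this
    exact Module.Finite.of_finite
  refine ⟨f.orthogonal H, finiteDimensional_orthogonal hf hH, fun W hW hHW z hz => ?_⟩
  obtain ⟨a, ⟨haH, haW⟩, hza⟩ := exists_mem_orthogonal_apply_eq_one
    (fun x y h => by rw [hs, h, neg_zero]) hHW hz
  refine ⟨H ⊓ f.orthogonal W ⊓ LinearMap.ker (f z), Submodule.span F {a},
    (hH.inf (cofg_orthogonal W)).inf (Submodule.CoFG.ker _), inferInstance, ?_⟩
  rintro v ⟨⟨hvH, hvW⟩, hvz⟩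
  have hb := hHq (add_mem haH hvH)
  refine ⟨LinearEquiv.transvection (f := f.flip (a + v)) (v := a + v) hb, hG _ fun x y => ?_,
    fun w hw => ?_, ?_⟩
  · change f (x + f x (a + v) • (a + v)) (y + f y (a + v) • (a + v)) = f x y
    simp only [map_add, LinearMap.add_apply, map_smul, LinearMap.smul_apply, smul_eq_mul] at hb ⊢
    rw [hs a y, hs v y]
    linear_combination (f x a + f x v) * (f y a + f y v) * hb
  · have h1 : f w a = 0 := haW w hw
    have h2 : f w v = 0 := hvW w hw
    change w + f w (a + v) • (a + v) = w
    simp [h1, h2]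
  · have h2 : f z v = 0 := hvz
    change z + f z (a + v) • (a + v) - z - v ∈ _
    simp [hza, h2, Submodule.mem_span_singleton_self]

/-- Otherwise, by polarization, `B` lies in its own orthogonal, which is finite-dimensional. -/
theorem exists_apply_self_ne_zero (hV : ¬ FiniteDimensional F V) (h2 : (2 : F) ≠ 0)
    (hf : ∀ x, (∀ y, f y x = 0) → x = 0) (hs : ∀ x y, f x y = f y x) {B : Submodule F V}
    (hB : B.CoFG) : ∃ p ∈ B, f p p ≠ 0 := by
  by_contra! h
  have hle : B ≤ f.orthogonal B := fun x hx y hy => by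
    have h1 := h _ (add_mem hx hy)
    simp only [map_add, LinearMap.add_apply, h x hx, h y hy, hs x y] at h1
    refine (mul_eq_zero.1 ?_).resolve_left h2
    linear_combination h1
  have := finiteDimensional_orthogonal hf hB
  have : FiniteDimensional F B := Submodule.finiteDimensional_of_le hle
  have : FiniteDimensional F (V ⧸ B) := hB
  exact hV (Module.Finite.of_submodule_quotient B)

/-- Two orthogonal anisotropic vectors suffice: over a finite field of odd order a non-degenerate
binary diagonal form represents every value. -/
theorem exists_apply_self_eq [Finite F] (hV : ¬ FiniteDimensional F V) (h2 : (2 : F) ≠ 0)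
    (hf : ∀ x, (∀ y, f y x = 0) → x = 0) (hs : ∀ x y, f x y = f y x) {B : Submodule F V}
    (hB : B.CoFG) (γ : F) : ∃ p ∈ B, f p p = γ := by
  obtain ⟨a, haB, ha⟩ := exists_apply_self_ne_zero hV h2 hf hs hB
  obtain ⟨b, ⟨hbB, hab⟩, hb⟩ := exists_apply_self_ne_zero hV h2 hf hs
    (hB.inf (Submodule.CoFG.ker (f a)))
  have hab : f a b = 0 := hab
  have := Fintype.ofFinite F
  have hodd : Fintype.card F % 2 = 1 := FiniteField.odd_card_of_char_ne_two fun h =>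
    h2 (by have := ringChar.Nat.cast_ringChar (R := F); rw [h] at this; exact_mod_cast this)
  obtain ⟨x, y, hxy⟩ := FiniteField.exists_root_sum_quadratic
    (f := Polynomial.C (f a a) * Polynomial.X ^ 2)
    (g := Polynomial.C (f b b) * Polynomial.X ^ 2 - Polynomial.C γ)
    (Polynomial.degree_C_mul_X_pow 2 ha)
    (by
      rw [Polynomial.degree_sub_C, Polynomial.degree_C_mul_X_pow 2 hb]
      · rfl
      · rw [Polynomial.degree_C_mul_X_pow 2 hb]; norm_num) hodd
  refine ⟨x • a + y • b, add_mem (B.smul_mem _ haB) (B.smul_mem _ hbB), ?_⟩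
  simp only [Polynomial.eval_mul, Polynomial.eval_C, Polynomial.eval_pow, Polynomial.eval_X,
    Polynomial.eval_sub] at hxy
  simp only [map_add, map_smul, LinearMap.add_apply, LinearMap.smul_apply, smul_eq_mul, hab,
    hs b a]
  linear_combination hxy

/-- The Siegel transformation of a symmetric form attached to an isotropic vector `u` and a vector
`v ⊥ u` with `f v v = 2 * q`. -/
def siegelMap (f : LinearMap.BilinForm F V) (u v : V) (q : F) : V →ₗ[F] V :=
  LinearMap.id + (f.flip u).smulRight v - (f.flip v).smulRight u - (q • f.flip u).smulRight u

theorem siegelMap_apply (u v : V) (q : F) (x : V) :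
    siegelMap f u v q x = x + f x u • v - f x v • u - (q * f x u) • u := rfl

theorem siegelMap_comp_neg (hs : ∀ x y, f x y = f y x) {u v : V} {q : F} (hu : f u u = 0)
    (huv : f v u = 0) (hq : f v v = 2 * q) :
    siegelMap f u v q ∘ₗ siegelMap f u (-v) q = LinearMap.id := by
  have huv' := hs v u ▸ huv
  ext x
  simp only [LinearMap.comp_apply, siegelMap_apply, map_add, map_sub, map_smul, map_neg,
    hu, huv, huv', hq, LinearMap.id_apply]
  module

theorem siegelMap_isometry (hs : ∀ x y, f x y = f y x) {u v : V} {q : F} (hu : f u u = 0)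
    (huv : f v u = 0) (hq : f v v = 2 * q) (x y : V) :
    f (siegelMap f u v q x) (siegelMap f u v q y) = f x y := by
  have huv' := hs v u ▸ huv
  simp only [siegelMap_apply, map_add, map_sub, map_smul,
    LinearMap.add_apply, LinearMap.sub_apply, LinearMap.smul_apply,
    smul_eq_mul, hu, huv, huv', hq, hs u y, hs v y]
  ring

/-- The Siegel transformation as a linear automorphism. -/
def siegelEquiv (hs : ∀ x y, f x y = f y x) {u v : V} {q : F} (hu : f u u = 0)
    (huv : f v u = 0) (hq : f v v = 2 * q) : V ≃ₗ[F] V :=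
  LinearEquiv.ofLinearMap (siegelMap f u v q) (siegelMap f u (-v) q)
    (siegelMap_comp_neg hs hu huv hq)
    (by simpa using siegelMap_comp_neg (v := -v) (q := q) hs hu (by simpa using huv)
          (by simpa using hq))

/-- Siegel transformations along a fixed isotropic `u ⊥ W` with `f z u = 1` fix `W` when `v ⊥ W`,
and send `z` to `z + v` modulo `u`. -/
theorem isRichOver_of_symm [Finite F] {G : Subgroup (V ≃ₗ[F] V)}
    (hG : ∀ g : V ≃ₗ[F] V, (∀ x y, f (g x) (g y) = f x y) → g ∈ G)
    (hV : ¬ FiniteDimensional F V) (h2 : (2 : F) ≠ 0)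
    (hf : ∀ x, (∀ y, f y x = 0) → x = 0) (hs : ∀ x y, f x y = f y x) :
    IsRichOver G ⊥ := by
  intro W hW _ z hz
  have htop : f.orthogonal ⊤ ≤ W := fun x hx => by
    rw [hf x fun y => hx y trivial]
    exact W.zero_mem
  obtain ⟨b, ⟨-, hbW⟩, hzb⟩ := exists_mem_orthogonal_apply_eq_one
    (fun x y h => by rw [hs, h]) htop hz
  -- Adding `p` makes `b` isotropic without changing its pairing with `W` or `z`.
  obtain ⟨p, ⟨⟨hpW, hpz⟩, hpb⟩, hp⟩ := exists_apply_self_eq hV h2 hf hs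
    (((cofg_orthogonal W).inf (Submodule.CoFG.ker (f z))).inf (Submodule.CoFG.ker (f b)))
    (- f b b)
  have hpz : f z p = 0 := hpz
  have hpb : f b p = 0 := hpb
  have hu : f (b + p) (b + p) = 0 := by simp [hpb, hs p b, hp]
  refine ⟨f.orthogonal W ⊓ LinearMap.ker (f (b + p)), Submodule.span F {b + p},
    (cofg_orthogonal W).inf (Submodule.CoFG.ker _), inferInstance, ?_⟩
  rintro v ⟨hvW, hvu⟩
  have hvu : f v (b + p) = 0 := by rw [hs]; exact hvu
  have hq : f v v = 2 * (f v v / 2) := by field_simp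
  refine ⟨siegelEquiv hs hu hvu hq, hG _ (siegelMap_isometry hs hu hvu hq), fun w hw => ?_, ?_⟩
  · have h1 : f w v = 0 := hvW w hw
    have h3 : f w b = 0 := hbW w hw
    have h4 : f w p = 0 := hpW w hw
    change siegelMap f (b + p) v _ w = w
    simp [siegelMap_apply, h1, h3, h4]
  · change siegelMap f (b + p) v _ z - z - v ∈ _
    refine Submodule.mem_span_singleton.2 ⟨- f z v - f v v / 2, ?_⟩
    simp only [siegelMap_apply, map_add, hzb, hpz]
    module

end RichGroups

/-! ### Words with constants, their values and contents -/

section WordValues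

variable {Γ : Type u} [Group Γ] {r : ℕ}

/-- `g` for the sign `true` and `g⁻¹` for the sign `false`. -/
def signPow (g : Γ) (b : Bool) : Γ := if b then g else g⁻¹

theorem map_signPow {Δ : Type v} [Group Δ] (φ : Γ →* Δ) (g : Γ) (b : Bool) :
    φ (signPow g b) = signPow (φ g) b := by
  cases b <;> simp [signPow]

theorem signPow_mul_signPow_not (g : Γ) (b : Bool) : signPow g (!b) * signPow g b = 1 := by
  cases b <;> simp [signPow]

/-- The value of the word with constants `c x_{ι(1)}^{ε(1)} c_1 ⋯`. -/
def evalWord (h : Fin r → Γ) (c : Γ) (L : List (Syllable Γ r)) : Γ :=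
  c * (L.map fun s => signPow (h s.var) s.sign * s.const).prod

theorem evalWord_nil (h : Fin r → Γ) (c : Γ) : evalWord h c [] = c := by
  simp [evalWord]

theorem evalWord_cons (h : Fin r → Γ) (c : Γ) (s : Syllable Γ r) (L : List (Syllable Γ r)) :
    evalWord h c (s :: L) = c * signPow (h s.var) s.sign * evalWord h s.const L := by
  simp [evalWord, mul_assoc]

theorem evalWord_mul (h : Fin r → Γ) (a c : Γ) (L : List (Syllable Γ r)) :
    evalWord h (a * c) L = a * evalWord h c L :=
  mul_assoc _ _ _

/-- The syllable with its constant replaced by its image. -/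
def Syllable.map {Δ : Type v} (φ : Γ → Δ) (s : Syllable Γ r) : Syllable Δ r :=
  ⟨s.var, s.sign, φ s.const⟩

theorem map_evalWord {Δ : Type v} [Group Δ] (φ : Γ →* Δ) (h : Fin r → Γ) (c : Γ)
    (L : List (Syllable Γ r)) :
    φ (evalWord h c L) = evalWord (fun i => φ (h i)) (φ c) (L.map (Syllable.map φ)) := by
  simp [evalWord, map_list_prod, Function.comp_def, map_signPow, Syllable.map]

theorem evalAt_toCoprod (h : Fin r → Γ) (e : WordExpr Γ r) :
    evalAt h e.toCoprod = evalWord h e.head e.tail := by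
  simp only [evalAt, WordExpr.toCoprod, evalWord, map_mul, map_list_prod, List.map_map,
    Monoid.Coprod.lift_apply_inl, MonoidHom.id_apply]
  congr 3
  funext s
  cases hs : s.sign <;> simp [Syllable.toCoprod, signPow, hs]

/-- The image in the free group of a word with constants. -/
def content {A : Type u} (L : List (Syllable A r)) : FreeGroup (Fin r) :=
  (L.map fun s => signPow (FreeGroup.of s.var) s.sign).prod

theorem content_map {A : Type u} {B : Type v} (φ : A → B) (L : List (Syllable A r)) :
    content (L.map (Syllable.map φ)) = content L := by
  simp [content, Function.comp_def, Syllable.map]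

theorem snd_toCoprod (e : WordExpr Γ r) : Monoid.Coprod.snd e.toCoprod = content e.tail := by
  simp only [WordExpr.toCoprod, content, map_mul, map_list_prod, List.map_map,
    Monoid.Coprod.snd_apply_inl, one_mul]
  congr 2
  funext s
  cases hs : s.sign <;> simp [Syllable.toCoprod, signPow, hs]

theorem exists_toCoprod_eq (w : Monoid.Coprod Γ (FreeGroup (Fin r))) :
    ∃ e : WordExpr Γ r, e.toCoprod = w := by
  have hletter : ∀ (i : Fin r) (b : Bool) (x : Monoid.Coprod Γ (FreeGroup (Fin r))),
      (∃ e : WordExpr Γ r, e.toCoprod = x) →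
        ∃ e : WordExpr Γ r, e.toCoprod = Monoid.Coprod.inr (signPow (FreeGroup.of i) b) * x := by
    rintro i b _ ⟨e, rfl⟩
    refine ⟨⟨1, ⟨i, b, e.head⟩ :: e.tail⟩, ?_⟩
    simp [WordExpr.toCoprod, Syllable.toCoprod, signPow, mul_assoc]
  induction w using Monoid.Coprod.induction_on' with
  | one => exact ⟨⟨1, []⟩, by simp [WordExpr.toCoprod]⟩
  | inl_mul g x hx =>
    obtain ⟨e, rfl⟩ := hx
    exact ⟨⟨g * e.head, e.tail⟩, by simp [WordExpr.toCoprod, mul_assoc]⟩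
  | inr_mul g x hx =>
    induction g using FreeGroup.induction_on generalizing x with
    | C1 => simpa using hx
    | of i => exact hletter i true x hx
    | inv_of i _ => exact hletter i false x hx
    | mul a b ha hb =>
      rw [map_mul, mul_assoc]
      exact ha _ (hb x hx)

end WordValues

/-! ### Trajectories of vectors under words -/

section Trajectories

variable {F : Type u} [Field F] {V : Type v} [AddCommGroup V] [Module F V]
  {G : Subgroup (V ≃ₗ[F] V)} {E : Submodule F V} {r : ℕ}

variable (G E r) in
/-- Elements of `G` together with finite-dimensional subspaces to which they are to be
restricted, such that both the subspaces and their images contain `E`. -/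
structure PartialTuple where
  /-- the elements of `G` -/
  val : Fin r → V ≃ₗ[F] V
  /-- the subspaces -/
  dom : Fin r → Submodule F V
  val_mem : ∀ i, val i ∈ G
  finiteDimensional_dom : ∀ i, FiniteDimensional F (dom i)
  le_dom : ∀ i, E ≤ dom i
  le_map : ∀ i, E ≤ (dom i).map (val i : V →ₗ[F] V)

namespace PartialTuple

attribute [instance] PartialTuple.finiteDimensional_dom

/-- The domain of the restriction of `val i`, or of its inverse. -/
def side (s : PartialTuple G E r) (i : Fin r) (b : Bool) : Submodule F V :=
  if b then s.dom i else (s.dom i).map (s.val i : V →ₗ[F] V)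

instance (s : PartialTuple G E r) (i : Fin r) (b : Bool) : FiniteDimensional F (s.side i b) := by
  cases b
  · exact inferInstanceAs (FiniteDimensional F ((s.dom i).map (s.val i : V →ₗ[F] V)))
  · exact s.finiteDimensional_dom i

/-- The tuple `h` extends the restrictions recorded in `s`. -/
def Compat (s : PartialTuple G E r) (h : Fin r → V ≃ₗ[F] V) : Prop :=
  ∀ i, ∀ x ∈ s.dom i, h i x = s.val i x

/-- The tuple `s'` extends the tuple `s`. -/
def Extends (s' s : PartialTuple G E r) : Prop :=
  (∀ i, s.dom i ≤ s'.dom i) ∧ s.Compat s'.val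

theorem Extends.compat {s' s : PartialTuple G E r} (h : s'.Extends s) {g : Fin r → V ≃ₗ[F] V}
    (hg : s'.Compat g) : s.Compat g := fun i x hx => by
  rw [hg i x (h.1 i hx), h.2 i x hx]

theorem Extends.refl (s : PartialTuple G E r) : s.Extends s :=
  ⟨fun _ => le_rfl, fun _ _ _ => rfl⟩

theorem Extends.trans {s₁ s₂ s₃ : PartialTuple G E r} (h : s₃.Extends s₂) (h' : s₂.Extends s₁) :
    s₃.Extends s₁ :=
  ⟨fun i => (h'.1 i).trans (h.1 i), h'.compat h.2⟩

theorem exists_update (s : PartialTuple G E r) (i : Fin r) {g : V ≃ₗ[F] V} (hg : g ∈ G)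
    (hgs : ∀ x ∈ s.dom i, g x = s.val i x) (y : V) :
    ∃ s' : PartialTuple G E r, s'.Extends s ∧
      (∀ h, s'.Compat h → h i y = g y) ∧
      (∀ j b, j ≠ i → s'.side j b = s.side j b) ∧
      s'.side i true = s.side i true ⊔ Submodule.span F {y} ∧
      s'.side i false = s.side i false ⊔ Submodule.span F {g y} := by
  classical
  have hmap : (s.dom i).map (g : V →ₗ[F] V) = (s.dom i).map (s.val i : V →ₗ[F] V) := by
    ext x
    simp only [Submodule.mem_map, LinearEquiv.coe_coe]
    exact exists_congr fun a => and_congr_right fun ha => by rw [hgs a ha]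
  have hval : ∀ j, Function.update s.val i g j ∈ G := fun j => by
    by_cases hj : j = i
    · subst hj; simpa using hg
    · simpa [hj] using s.val_mem j
  have hle : ∀ j, s.dom j ≤ Function.update s.dom i (s.dom i ⊔ Submodule.span F {y}) j :=
    fun j => by
      by_cases hj : j = i
      · subst hj; simp
      · simp [hj]
  have heq : ∀ j, ∀ x ∈ s.dom j, Function.update s.val i g j x = s.val j x := fun j x hx => by
    by_cases hj : j = i
    · subst hj; simpa using hgs x hx
    · simp [hj]
  refine ⟨⟨Function.update s.val i g, Function.update s.dom i (s.dom i ⊔ Submodule.span F {y}),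
    hval, fun j => ?_, fun j => (s.le_dom j).trans (hle j), fun j x hx => ?_⟩, ⟨hle, heq⟩,
    fun h hh => ?_, fun j b hj => ?_, ?_, ?_⟩
  · by_cases hj : j = i
    · subst hj
      rw [Function.update_self]
      infer_instance
    · rw [Function.update_of_ne hj]
      infer_instance
  · obtain ⟨a, ha, rfl⟩ := s.le_map j hx
    exact ⟨a, hle j ha, heq j a ha⟩
  · have hy := hh i y (by
      simpa using Submodule.mem_sup_right (Submodule.mem_span_singleton_self y))
    simpa using hy
  · cases b <;> simp [side, hj]
  · simp [side]
  · simp [side, Submodule.map_sup, hmap, Submodule.map_span]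

/-- While `z` is outside the relevant side, its image is still free: composing `val i` with an
element fixing the committed part moves that image to a generic `y`. Only the opposite side of the
same variable acquires `y`; every other side grows by at most `z`. -/
theorem exists_extends [Finite F] (hV : ¬ FiniteDimensional F V) (hG : IsRichOver G E)
    (s : PartialTuple G E r) {i : Fin r} {b : Bool} {z : V} (hz : z ∉ s.side i b)
    (U : Submodule F V) [FiniteDimensional F U] (d : V ≃ₗ[F] V) :
    ∃ (s' : PartialTuple G E r) (y : V), s'.Extends s ∧
      (∀ h, s'.Compat h → signPow (h i) b z = y) ∧ d y ∉ U ∧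
      (¬ IsScalarModFiniteRange d → d y ∉ U ⊔ Submodule.span F {y}) ∧
      (∀ j c, (j = i → b ≠ !c) → s'.side j c ≤ s.side j c ⊔ Submodule.span F {z}) ∧
      s'.side i (!b) ≤ s.side i (!b) ⊔ Submodule.span F {y} := by
  cases b with
  | true =>
    have hz' : s.val i z ∉ (s.dom i).map (s.val i : V →ₗ[F] V) := by
      rintro ⟨a, ha, haz⟩
      exact hz ((s.val i).injective haz ▸ ha)
    obtain ⟨t, htG, ht, hd, hd'⟩ := hG.exists_generic hV (U := U) (s.le_map i) hz' d
    obtain ⟨s', hs', hval, hne, htrue, hfalse⟩ := s.exists_update i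
      (G.mul_mem htG (s.val_mem i)) (fun x hx => ht _ (Submodule.mem_map_of_mem hx)) z
    refine ⟨s', t (s.val i z), hs', hval, hd, hd', fun j c hjc => ?_, hfalse.le⟩
    by_cases hj : j = i
    · subst hj
      cases c with
      | true => exact htrue.le
      | false => exact absurd rfl (hjc rfl)
    · rw [hne j c hj]
      exact le_sup_left
  | false =>
    have hz' : (s.val i).symm z ∉ s.dom i := fun h =>
      hz ⟨_, h, (s.val i).apply_symm_apply z⟩
    obtain ⟨t, htG, ht, hd, hd'⟩ := hG.exists_generic hV (U := U) (s.le_dom i) hz' d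
    have hy : (s.val i * t⁻¹) (t ((s.val i).symm z)) = z := by
      change s.val i (t.symm (t _)) = z
      simp
    obtain ⟨s', hs', hval, hne, htrue, hfalse⟩ := s.exists_update i
      (G.mul_mem (s.val_mem i) (G.inv_mem htG)) (fun x hx => by
        change s.val i (t.symm x) = _
        rw [t.symm_apply_eq.2 (ht x hx).symm]) (t ((s.val i).symm z))
    rw [hy] at hfalse
    refine ⟨s', t ((s.val i).symm z), hs', fun h hh => ?_, hd, hd', fun j c hjc => ?_, htrue.le⟩
    · change (h i).symm z = _
      rw [LinearEquiv.symm_apply_eq, hval h hh, hy]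
    by_cases hj : j = i
    · subst hj
      cases c with
      | true => exact absurd rfl (hjc rfl)
      | false => exact hfalse.le
    · rw [hne j c hj]
      exact le_sup_left

end PartialTuple

/-- No critical constant is a scalar modulo finite rank. -/
def IsGood (L : List (Syllable (V ≃ₗ[F] V) r)) : Prop :=
  L.IsChain fun s t => s.var = t.var → s.sign = !t.sign → ¬ IsScalarModFiniteRange s.const

theorem IsGood.exists_trajectory [Finite F] (hV : ¬ FiniteDimensional F V)
    (hG : IsRichOver G E) {L : List (Syllable (V ≃ₗ[F] V) r)} (hL : IsGood L) (c : V ≃ₗ[F] V)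
    (s : PartialTuple G E r) (U : Submodule F V) [FiniteDimensional F U] (i : Fin r) (b : Bool)
    (hc : ∀ t ∈ L.head?, i = t.var → b = !t.sign → ¬ IsScalarModFiniteRange c) :
    ∃ v, ∃ (s' : PartialTuple G E r) (y : V), s'.Extends s ∧ y ∉ s'.side i b ∧
      (L ≠ [] → y ∉ U ⊔ Submodule.span F {v}) ∧ ∀ h, s'.Compat h → evalWord h c L v = y := by
  induction L generalizing c i b with
  | nil =>
    obtain ⟨y, hy⟩ := exists_notMem_of_not_finiteDimensional hV (s.side i b)
    exact ⟨c.symm y, s, y, .refl s, hy, fun h => absurd rfl h, fun h _ => by simp [evalWord_nil]⟩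
  | cons t L ih =>
    obtain ⟨hL1, hL2⟩ := List.isChain_cons.1 hL
    obtain ⟨v, s₁, z, hs₁, hz, -, hzv⟩ := ih hL2 t.const t.var t.sign fun t' ht' => hL1 t' ht'
    obtain ⟨s₂, y, hs₂, hy, hd, hd', hside, hside'⟩ := s₁.exists_extends hV hG hz
      (s₁.side i b ⊔ Submodule.span F {z} ⊔ (U ⊔ Submodule.span F {v})) c
    refine ⟨v, s₂, c y, hs₂.trans hs₁, ?_, fun _ h => hd (Submodule.mem_sup_right h),
      fun h hh => ?_⟩
    -- Exactly when `c` is critical does the side to be avoided contain the new vector `y`; this is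
    -- where `c` must not be scalar modulo finite rank.
    · by_cases hib : i = t.var ∧ b = !t.sign
      · obtain ⟨rfl, rfl⟩ := hib
        intro h
        refine hd' (hc t (by simp) rfl rfl) (SetLike.le_def.1 (sup_le_sup_right ?_ _) (hside' h))
        exact le_sup_left.trans le_sup_left
      · intro h
        refine hd (Submodule.mem_sup_left (hside i b (fun h1 h2 => hib ⟨h1, ?_⟩) h))
        rw [h2, Bool.not_not]
    · rw [evalWord_cons]
      change c (signPow (h t.var) t.sign (evalWord h t.const L v)) = c y
      rw [hzv h (hs₂.compat hh), hy h hh]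

theorem IsGood.exists_le_finrank [Finite F] (hV : ¬ FiniteDimensional F V)
    (hG : IsRichOver G E) [FiniteDimensional F E] {L : List (Syllable (V ≃ₗ[F] V) r)}
    (hL : IsGood L) (hne : L ≠ []) (c : V ≃ₗ[F] V) (N : ℕ) :
    ∃ (s : PartialTuple G E r) (S : Submodule F V), FiniteDimensional F S ∧
      N ≤ Module.finrank F S ∧ ∀ h, s.Compat h →
        S ≤ LinearMap.range (LinearMap.id - (evalWord h c L).toLinearMap) := by
  induction N with
  | zero =>
    refine ⟨⟨fun _ => 1, fun _ => E, fun _ => G.one_mem, fun _ => inferInstance,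
      fun _ => le_rfl, fun _ x hx => ⟨x, hx, rfl⟩⟩, ⊥, inferInstance, by simp, fun _ _ => bot_le⟩
  | succ N ih =>
    obtain ⟨s, S, hSfin, hSN, hS⟩ := ih
    obtain ⟨t, L, rfl⟩ := List.exists_cons_of_ne_nil hne
    -- No letter precedes the word; passing the first letter itself makes the criticality condition
    -- vacuous.
    obtain ⟨v, s', y, hs', -, hy, heval⟩ := hL.exists_trajectory hV hG c s S t.var t.sign (by
      rintro t' ht' - h
      obtain rfl : t = t' := by simpa using ht'
      simp at h)
    refine ⟨s', S ⊔ Submodule.span F {v - y}, inferInstance, ?_, fun h hh => sup_le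
      (hS h (hs'.compat hh)) ?_⟩
    · refine hSN.trans_lt (Submodule.finrank_lt_finrank_of_lt (left_lt_sup.2 fun hle => ?_))
      refine hy hne ?_
      have h1 : v - y ∈ S := hle (Submodule.mem_span_singleton_self _)
      have h2 : y = v - (v - y) := by abel
      rw [h2]
      exact sub_mem (Submodule.mem_sup_right (Submodule.mem_span_singleton_self v))
        (Submodule.mem_sup_left h1)
    · rw [Submodule.span_singleton_le_iff_mem]
      exact ⟨v, by simp [heval h hh]⟩

/-- A bad critical constant `b = μ + (finite rank)` may be replaced by the central scalar `μ`, after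
which the two neighbouring letters cancel. Each such step costs bounded rank, uniformly in `h`. -/
theorem exists_isGood (hV : ¬ FiniteDimensional F V) (L : List (Syllable (V ≃ₗ[F] V) r))
    (c : V ≃ₗ[F] V) :
    ∃ (c' : V ≃ₗ[F] V) (L' : List (Syllable (V ≃ₗ[F] V) r)), IsGood L' ∧
      content L' = content L ∧ ∃ N : ℕ, ∀ h, LinearMap.rank
        ((evalWord h c L).toLinearMap - (evalWord h c' L').toLinearMap) ≤ N := by
  induction L generalizing c with
  | nil => exact ⟨c, [], List.IsChain.nil, rfl, 0, fun h => by simp⟩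
  | cons s L ih =>
    obtain ⟨b, M, hM, hcont, N, hN⟩ := ih s.const
    have hle : ∀ h, LinearMap.rank ((c * signPow (h s.var) s.sign).toLinearMap ∘ₗ
        ((evalWord h s.const L).toLinearMap - (evalWord h b M).toLinearMap)) ≤ N := fun h =>
      (LinearMap.rank_comp_le_right _ _).trans (hN h)
    by_cases hred : ∃ t ∈ M.head?, s.var = t.var ∧ s.sign = !t.sign ∧ IsScalarModFiniteRange b
    · obtain ⟨t, ht, hvar, hsign, μ, hμ⟩ := hred
      obtain ⟨M, rfl⟩ : ∃ M', M = t :: M' := ⟨M.tail, List.eq_cons_of_mem_head? ht⟩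
      have hμ0 : μ ≠ 0 := by
        rintro rfl
        exact not_finiteDimensional_range hV b (by rwa [zero_smul, sub_zero] at hμ)
      refine ⟨c * LinearEquiv.smulOfNeZero F V μ hμ0 * t.const, M, hM.tail, ?_,
        N + Module.finrank F (LinearMap.range ((b : V →ₗ[F] V) - μ • LinearMap.id)),
        fun h => ?_⟩
      · simp only [content, List.map_cons, List.prod_cons] at hcont ⊢
        rw [← hcont, ← mul_assoc, hvar, hsign, signPow_mul_signPow_not, one_mul]
      · have hsplit : (evalWord h c (s :: L)).toLinearMap -
            (evalWord h (c * LinearEquiv.smulOfNeZero F V μ hμ0 * t.const) M).toLinearMap =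
            (c * signPow (h s.var) s.sign).toLinearMap ∘ₗ
              ((evalWord h s.const L).toLinearMap - (evalWord h b (t :: M)).toLinearMap) +
            ((c * signPow (h s.var) s.sign).toLinearMap ∘ₗ
              ((b : V →ₗ[F] V) - μ • LinearMap.id)) ∘ₗ
              (signPow (h t.var) t.sign * evalWord h t.const M).toLinearMap := by
          ext v
          have hcancel : ∀ x, signPow (h s.var) s.sign (signPow (h t.var) t.sign x) = x :=
            fun x => by
              rw [hvar, hsign]
              exact LinearEquiv.congr_fun (signPow_mul_signPow_not (h t.var) t.sign) x
          rw [evalWord_cons, evalWord_cons, evalWord_mul]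
          simp [hcancel]
        rw [hsplit, Nat.cast_add]
        refine (LinearMap.rank_add_le _ _).trans (add_le_add (hle h) ?_)
        refine (LinearMap.rank_comp_le_left _ _).trans ((LinearMap.rank_comp_le_right _ _).trans ?_)
        rw [Module.finrank_eq_rank]
    · refine ⟨c, ⟨s.var, s.sign, b⟩ :: M, List.isChain_cons.2 ⟨fun t ht h1 h2 h3 =>
        hred ⟨t, ht, h1, h2, h3⟩, hM⟩, ?_, N, fun h => ?_⟩
      · simp only [content, List.map_cons, List.prod_cons] at hcont ⊢
        rw [hcont]
      · rw [evalWord_cons, evalWord_cons]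
        convert hle h using 2
        ext v
        simp

variable {Γ : Type w} [Group Γ] {ρ : Γ →* V ≃ₗ[F] V}

theorem not_forall_rank_le [Finite F] (hV : ¬ FiniteDimensional F V) [FiniteDimensional F E]
    (hG : IsRichOver ρ.range E) {L : List (Syllable (V ≃ₗ[F] V) r)} (hL : IsGood L)
    (hne : L ≠ []) (c : V ≃ₗ[F] V) (N : ℕ) : ∃ h : Fin r → Γ, ¬ LinearMap.rank
      (LinearMap.id - (evalWord (fun i => ρ (h i)) c L).toLinearMap) ≤ N := by
  obtain ⟨s, S, hSfin, hSN, hS⟩ := hL.exists_le_finrank hV hG hne c (N + 1)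
  choose h hh using s.val_mem
  refine ⟨h, fun hle => ?_⟩
  have h1 := hS _ fun i x _ => LinearEquiv.congr_fun (hh i) x
  have h2 := (Submodule.rank_mono h1).trans hle
  rw [← Module.finrank_eq_rank, Nat.cast_le] at h2
  omega

theorem not_isMixedIdentity_of_isNonsingular [Finite F] (hV : ¬ FiniteDimensional F V)
    [FiniteDimensional F E] (hG : IsRichOver ρ.range E)
    (w : Monoid.Coprod Γ (FreeGroup (Fin r))) : ¬ (IsMixedIdentity w ∧ IsNonsingular w) := by
  rintro ⟨⟨-, hw⟩, hns⟩
  obtain ⟨e, rfl⟩ := exists_toCoprod_eq w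
  obtain ⟨c, L, hL, hcont, N, hN⟩ := exists_isGood hV (e.tail.map (Syllable.map ρ)) (ρ e.head)
  have hne : L ≠ [] := by
    rintro rfl
    rw [content_map, ← snd_toCoprod] at hcont
    exact hns hcont.symm
  obtain ⟨h, hh⟩ := not_forall_rank_le hV hG hL hne c N
  refine hh ?_
  have h1 := hN fun i => ρ (h i)
  rw [← map_evalWord, ← evalAt_toCoprod, hw h, map_one] at h1
  exact h1

theorem exists_isCriticalConstant [Finite F] (hV : ¬ FiniteDimensional F V)
    [FiniteDimensional F E] (hG : IsRichOver ρ.range E) (e : WordExpr Γ r)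
    (he : IsMixedIdentity e.toCoprod) :
    ∃ c, e.IsCriticalConstant c ∧ IsScalarModFiniteRange (ρ c) := by
  by_contra! hcrit
  -- The expression itself is already good, so no reduction is needed and rank bound `0` gives the
  -- contradiction.
  have hL : IsGood (e.tail.map (Syllable.map ρ)) := by
    rw [IsGood, List.isChain_map, List.isChain_iff_forall_rel_of_append_cons_cons]
    intro s t l₁ l₂ hl hvar hsign
    exact hcrit _ ⟨s, t, ⟨l₁, l₂, by simp [hl]⟩, hvar, hsign, rfl⟩
  have hval : ∀ h : Fin r → Γ, evalWord h e.head e.tail = 1 := fun h => by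
    rw [← evalAt_toCoprod]
    exact he.2 h
  have hne : e.tail ≠ [] := fun h => he.1 <| by
    have h1 := hval 1
    rw [h, evalWord_nil] at h1
    simp [WordExpr.toCoprod, h, h1]
  obtain ⟨h, hh⟩ := not_forall_rank_le hV hG hL (by simpa using hne) (ρ e.head) 0
  rw [← map_evalWord, hval, map_one] at hh
  refine hh ?_
  have : LinearMap.id - (1 : V ≃ₗ[F] V).toLinearMap = 0 := sub_self _
  rw [this]
  simp

end Trajectories

theorem rank_lt_aleph0_iff_finiteDimensional_range {F : Type u} [Field F] {V : Type v}
    [AddCommGroup V] [Module F V] (g : V →ₗ[F] V) :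
    LinearMap.rank g < ℵ₀ ↔ FiniteDimensional F (LinearMap.range g) :=
  Module.rank_lt_aleph0_iff

/-! ### Definable sets, algebraic closure and slenderness -/

section SlenderCriterion

theorem exists_finset_fixing {L : FirstOrder.Language.{u, v}} {X : Type w} [L.Structure X]
    {Z : Set X} (hZ : (Set.univ : Set X).Definable₁ L Z) :
    ∃ A : Finset X, ∀ φ : X ≃[L] X, (∀ a ∈ A, φ a = a) → ∀ z ∈ Z, φ z ∈ Z := by
  obtain ⟨A, -, hA⟩ := Set.definable_iff_finitely_definable.1 hZ
  obtain ⟨ψ, hψ⟩ := Set.definable_iff_exists_formula_sum.1 hA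
  have hmem : ∀ z, z ∈ Z ↔ ψ.Realize (Sum.elim (fun a : (A : Set X) => (a : X)) fun _ => z) :=
    fun z => Set.ext_iff.1 hψ fun _ => z
  refine ⟨A, fun φ hφ z hz => ?_⟩
  rw [hmem] at hz ⊢
  rw [← FirstOrder.Language.StrongHomClass.realize_formula φ] at hz
  convert hz using 1
  funext i
  rcases i with a | i
  · exact (hφ a a.2).symm
  · rfl

variable {F : Type u} [Field F] {V : Type w} [AddCommGroup V] [Module F V]
  {L : FirstOrder.Language.{v, u}} [L.Structure V]

/-- A map preserving all linear relations is linear. -/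
theorem exists_linearMap_of_relations (φ : V → V)
    (h : ∀ {n : ℕ} (a : Fin n → F) (x : Fin n → V), ∑ i, a i • x i = 0 →
      ∑ i, a i • φ (x i) = 0) :
    ∃ g : V →ₗ[F] V, ∀ x, φ x = g x := by
  refine ⟨⟨⟨φ, fun x y => ?_⟩, fun a x => ?_⟩, fun x => rfl⟩
  · have h1 := h ![1, 1, -1] ![x, y, x + y] (by
      simp only [Fin.sum_univ_three, Matrix.cons_val]
      module)
    simp only [Fin.sum_univ_three] at h1
    simpa [add_neg_eq_zero, eq_comm] using h1
  · have h1 := h ![a, -1] ![x, a • x] (by simp)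
    simp only [Fin.sum_univ_two] at h1
    simpa [add_neg_eq_zero, eq_comm] using h1

theorem span_subset_acl
    (hlin : ∀ φ : V ≃[L] V, ∃ g : V →ₗ[F] V, ∀ x, φ x = g x) {Y : Set V} (hY : Y.Finite) :
    (Submodule.span F Y : Set V) ⊆ acl L Y := by
  intro x hx
  refine ⟨Y, hY, subset_rfl, (Set.finite_singleton x).subset ?_⟩
  rintro _ ⟨φ, hφ, rfl⟩
  obtain ⟨g, hg⟩ := hlin φ
  rw [Set.mem_singleton_iff, hg]
  exact LinearMap.eqOn_span (g := LinearMap.id) (fun a ha => by rw [← hg, hφ a ha]; rfl) hx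

variable [Finite F] {G : Subgroup (V ≃ₗ[F] V)} {E : Submodule F V} [FiniteDimensional F E]

/-- A finite orbit spans a finite-dimensional subspace, which a generic point of the orbit, taken
with `d = 1`, escapes. -/
theorem acl_subset_span_sup (hV : ¬ FiniteDimensional F V) (hE : IsRichOver G E)
    (hG : ∀ g ∈ G, ∃ φ : V ≃[L] V, ∀ x, φ x = g x) (Y : Set V) :
    acl L Y ⊆ (Submodule.span F Y ⊔ E : Submodule F V) := by
  rintro x ⟨W, hW, hWY, horb⟩
  have : FiniteDimensional F (Submodule.span F W) := FiniteDimensional.span_of_finite F hW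
  have := FiniteDimensional.span_of_finite F horb
  by_contra hx
  have hx' : x ∉ Submodule.span F W ⊔ E := fun h =>
    hx (SetLike.le_def.1 (sup_le_sup_right (Submodule.span_mono hWY) E) h)
  obtain ⟨t, htG, ht, hnot, -⟩ := hE.exists_generic hV (U := Submodule.span F
    {y | ∃ g : V ≃[L] V, (∀ a ∈ W, g a = a) ∧ g x = y}) le_sup_right hx' 1
  obtain ⟨φ, hφ⟩ := hG t htG
  refine hnot (Submodule.subset_span ⟨φ, fun a ha => ?_, hφ x⟩)
  rw [hφ]
  exact ht a (Submodule.mem_sup_left (Submodule.subset_span ha))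

theorem isSlender_iff (hV : ¬ FiniteDimensional F V) (hE : IsRichOver G E)
    (hG : ∀ g ∈ G, ∃ φ : V ≃[L] V, ∀ x, φ x = g x)
    (hlin : ∀ φ : V ≃[L] V, ∃ g : V →ₗ[F] V, ∀ x, φ x = g x)
    {c : V ≃[L] V} {d : V ≃ₗ[F] V} (hcd : ∀ x, c x = d x) :
    IsSlender L c ↔ IsScalarModFiniteRange d := by
  constructor
  · rintro ⟨Y, Z, hY, hZinf, hZdef, hZ⟩
    obtain ⟨A, hA⟩ := exists_finset_fixing hZdef
    have := FiniteDimensional.span_of_finite F hY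
    let W := Submodule.span F (A : Set V) ⊔ E
    have hWfin : (W : Set V).Finite := by
      have : Finite W := Module.finite_of_finite F
      exact Set.toFinite _
    -- The stabilizer of `W` fixes the parameters of `Z`, so all images `t z` stay in `Z` and
    -- slenderness constrains `d` on each of them.
    obtain ⟨z, hz, hzW⟩ := hZinf.exists_notMem_finite hWfin
    obtain ⟨μ, -, hμ⟩ := hE.exists_finiteDimensional_range (U := Submodule.span F Y ⊔ E)
      le_sup_right hzW (d : V →ₗ[F] V) Set.univ fun t htG ht => by
        obtain ⟨φ, hφ⟩ := hG t htG
        have htz : t z ∈ Z := by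
          rw [← hφ]
          refine hA φ (fun a ha => ?_) z hz
          rw [hφ]
          exact ht a (Submodule.mem_sup_left (Submodule.subset_span ha))
        have hmem := acl_subset_span_sup hV hE hG _ (hZ htz)
        rw [hcd, Submodule.span_union, sup_right_comm] at hmem
        obtain ⟨x, hx, y, hy, hxy⟩ := Submodule.mem_sup.1 hmem
        obtain ⟨μ, rfl⟩ := Submodule.mem_span_singleton.1 hy
        refine ⟨μ, trivial, ?_⟩
        rw [LinearEquiv.coe_coe, ← hxy, add_sub_cancel_right]
        exact hx
    exact ⟨μ, hμ⟩
  · rintro ⟨μ, hμ⟩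
    have hfin : (LinearMap.range ((d : V →ₗ[F] V) - μ • LinearMap.id) : Set V).Finite := by
      have := Module.finite_of_finite F
        (M := LinearMap.range ((d : V →ₗ[F] V) - μ • LinearMap.id))
      exact Set.toFinite _
    -- Here `Y` is the range of `d - μ`, which is finite because `F` is, and `Z` is the whole space.
    refine ⟨_, Set.univ, hfin, ?_, ?_, fun x _ => span_subset_acl hlin
      (hfin.union (Set.finite_singleton x)) ?_⟩
    · rw [Set.infinite_univ_iff, ← not_finite_iff_infinite]
      exact fun _ => hV Module.Finite.of_finite
    · exact Set.definable_univ
    · have h1 : c x = ((d : V →ₗ[F] V) - μ • LinearMap.id : V →ₗ[F] V) x + μ • x := by simp [hcd]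
      rw [h1]
      exact add_mem (Submodule.subset_span (Or.inl ⟨x, rfl⟩))
        (Submodule.smul_mem _ _ (Submodule.subset_span (Or.inr rfl)))

end SlenderCriterion

/-! ### Specialization to the countable-dimensional space -/

section Space

variable {F : Type u} [Field F]

theorem not_finiteDimensional_space : ¬ FiniteDimensional F (Space F) := by
  intro h
  have := (Finsupp.basisSingleOne (R := F) (ι := ℕ)).linearIndependent.finite
  exact not_finite ℕ

theorem isScalarModFiniteRank_iff {c : LinAut F} :
    IsScalarModFiniteRank c ↔ IsScalarModFiniteRange c :=
  exists_congr fun _ => rank_lt_aleph0_iff_finiteDimensional_range _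

theorem exists_linearMap_of_vecAut (φ : Space F ≃[vecLang F] Space F) :
    ∃ g : Space F →ₗ[F] Space F, ∀ x, φ x = g x :=
  exists_linearMap_of_relations φ fun {n} a x hx =>
    (φ.map_rel (show (vecLang F).Relations n from a) x).2 hx

theorem exists_linearMap_of_formAut (f : LinearMap.BilinForm F (Space F)) :
    letI := formStructure f
    ∀ φ : Space F ≃[formLang F] Space F, ∃ g : Space F →ₗ[F] Space F, ∀ x, φ x = g x :=
  letI := formStructure f
  fun φ => exists_linearMap_of_relations φ fun {n} a x hx =>
    (φ.map_rel (show (formLang F).Relations n from FormRel.lin a) x).2 hx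

variable [Finite F]

theorem isSlenderLinear_iff (c : LinAut F) : IsSlenderLinear c ↔ IsScalarModFiniteRank c := by
  rw [isScalarModFiniteRank_iff]
  exact isSlender_iff not_finiteDimensional_space isRichOver_top
    (fun g _ => ⟨toVecAut g, fun _ => rfl⟩) exists_linearMap_of_vecAut fun _ => rfl

theorem isSlenderIsometry_iff {f : LinearMap.BilinForm F (Space F)} {E : Submodule F (Space F)}
    [FiniteDimensional F E] (hE : IsRichOver (isometryGroup f) E) (c : isometryGroup f) :
    IsSlenderIsometry f c ↔ IsScalarModFiniteRank (c : LinAut F) := by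
  rw [isScalarModFiniteRank_iff]
  let := formStructure f
  exact isSlender_iff not_finiteDimensional_space hE
    (fun g hg => ⟨toFormAut f ⟨g, hg⟩, fun _ => rfl⟩) (exists_linearMap_of_formAut f)
    fun _ => rfl

theorem isometryGroup_properties {f : LinearMap.BilinForm F (Space F)}
    (hf : ∃ E : Submodule F (Space F), FiniteDimensional F E ∧ IsRichOver (isometryGroup f) E) :
    (∀ (r : ℕ) (w : Monoid.Coprod (isometryGroup f) (FreeGroup (Fin r))),
        ¬ (IsMixedIdentity w ∧ IsNonsingular w)) ∧
      (∀ (r : ℕ) (e : WordExpr (isometryGroup f) r), IsMixedIdentity e.toCoprod →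
        ∃ c, e.IsCriticalConstant c ∧ IsScalarModFiniteRank (c : LinAut F)) ∧
      (∀ c : isometryGroup f, IsSlenderIsometry f c ↔ IsScalarModFiniteRank (c : LinAut F)) := by
  obtain ⟨E, _, hE⟩ := hf
  have hE' : IsRichOver (isometryGroup f).subtype.range E := by rwa [Subgroup.range_subtype]
  refine ⟨fun r w => not_isMixedIdentity_of_isNonsingular not_finiteDimensional_space hE' w,
    fun r e he => ?_, isSlenderIsometry_iff hE⟩
  obtain ⟨c, hc, hc'⟩ := exists_isCriticalConstant not_finiteDimensional_space hE' e he
  exact ⟨c, hc, isScalarModFiniteRank_iff.2 hc'⟩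

theorem exists_isRichOver_isometryGroup_of_isAlt {f : LinearMap.BilinForm F (Space F)}
    (hf : f.Nondegenerate) (hs : f.IsAlt) :
    ∃ E : Submodule F (Space F), FiniteDimensional F E ∧ IsRichOver (isometryGroup f) E :=
  exists_isRichOver_of_skew (fun _ hg => hg) hf.2 fun x y => (hs.neg_eq y x).symm

theorem exists_isRichOver_isometryGroup_of_isSymm {f : LinearMap.BilinForm F (Space F)}
    (hf : f.Nondegenerate) (hs : f.IsSymm) :
    ∃ E : Submodule F (Space F), FiniteDimensional F E ∧ IsRichOver (isometryGroup f) E := by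
  -- Siegel transformations need division by 2; in characteristic 2 a symmetric form is skew.
  by_cases h2 : (2 : F) = 0
  · refine exists_isRichOver_of_skew (fun _ hg => hg) hf.2 fun x y => ?_
    have h1 : f x y = f y x := hs.eq x y
    linear_combination h1 + f y x * h2
  · exact ⟨⊥, inferInstance, isRichOver_of_symm (fun _ hg => hg) not_finiteDimensional_space h2
      hf.2 hs.eq⟩

end Space

end MixedIdentity

theorem mainTheorem4 {F : Type*} [Field F] [Finite F] :
    -- the general linear group
    ((∀ (r : ℕ) (w : Monoid.Coprod (MixedIdentity.LinAut F) (FreeGroup (Fin r))),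
        ¬ (MixedIdentity.IsMixedIdentity w ∧ MixedIdentity.IsNonsingular w)) ∧
      (∀ (r : ℕ) (e : MixedIdentity.WordExpr (MixedIdentity.LinAut F) r),
        MixedIdentity.IsMixedIdentity e.toCoprod →
          ∃ c, e.IsCriticalConstant c ∧ MixedIdentity.IsScalarModFiniteRank c) ∧
      (∀ c : MixedIdentity.LinAut F,
        MixedIdentity.IsSlenderLinear c ↔ MixedIdentity.IsScalarModFiniteRank c)) ∧
    -- orthogonal groups
    (∀ f : LinearMap.BilinForm F (MixedIdentity.Space F), f.Nondegenerate → f.IsSymm →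
      (∀ (r : ℕ) (w : Monoid.Coprod (MixedIdentity.isometryGroup f) (FreeGroup (Fin r))),
        ¬ (MixedIdentity.IsMixedIdentity w ∧ MixedIdentity.IsNonsingular w)) ∧
      (∀ (r : ℕ) (e : MixedIdentity.WordExpr (MixedIdentity.isometryGroup f) r),
        MixedIdentity.IsMixedIdentity e.toCoprod →
          ∃ c, e.IsCriticalConstant c ∧
            MixedIdentity.IsScalarModFiniteRank (c : MixedIdentity.LinAut F)) ∧
      (∀ c : MixedIdentity.isometryGroup f,
        MixedIdentity.IsSlenderIsometry f c ↔
          MixedIdentity.IsScalarModFiniteRank (c : MixedIdentity.LinAut F))) ∧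
    -- symplectic groups
    (∀ f : LinearMap.BilinForm F (MixedIdentity.Space F), f.Nondegenerate → f.IsAlt →
      (∀ (r : ℕ) (w : Monoid.Coprod (MixedIdentity.isometryGroup f) (FreeGroup (Fin r))),
        ¬ (MixedIdentity.IsMixedIdentity w ∧ MixedIdentity.IsNonsingular w)) ∧
      (∀ (r : ℕ) (e : MixedIdentity.WordExpr (MixedIdentity.isometryGroup f) r),
        MixedIdentity.IsMixedIdentity e.toCoprod →
          ∃ c, e.IsCriticalConstant c ∧
            MixedIdentity.IsScalarModFiniteRank (c : MixedIdentity.LinAut F)) ∧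
      (∀ c : MixedIdentity.isometryGroup f,
        MixedIdentity.IsSlenderIsometry f c ↔
          MixedIdentity.IsScalarModFiniteRank (c : MixedIdentity.LinAut F))) := by
  open MixedIdentity in
  refine ⟨⟨fun r w => ?_, fun r e he => ?_, isSlenderLinear_iff⟩,
    fun f hf hs => isometryGroup_properties (exists_isRichOver_isometryGroup_of_isSymm hf hs),
    fun f hf hs => isometryGroup_properties (exists_isRichOver_isometryGroup_of_isAlt hf hs)⟩
  · exact not_isMixedIdentity_of_isNonsingular (ρ := MonoidHom.id _) (E := ⊥)
      not_finiteDimensional_space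
      (by rw [MonoidHom.range_eq_top.2 Function.surjective_id]; exact isRichOver_top) w
  · obtain ⟨c, hc, hc'⟩ := exists_isCriticalConstant (ρ := MonoidHom.id _) (E := ⊥)
      not_finiteDimensional_space
      (by rw [MonoidHom.range_eq_top.2 Function.surjective_id]; exact isRichOver_top) e he
    exact ⟨c, hc, isScalarModFiniteRank_iff.2 hc'⟩
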